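/- Let $\mathcal{MG}$ be a discounted two-player Markov game with finite state space $\mathcal S$, finite action spaces $\mathcal A_1,\mathcal A_2$, rewards $r_i:\mathcal S\times\mathcal A_1\times\mathcal A_2\to[0,1]$, transition kernel $P$ and discount factor $\gamma\in[0,1)$. Write $\Delta(X)$ for the set of probability vectors on a finite set $X$, and $-i$ for the player other than $i$. For $i\in\{1,2\}$ let $\tau_i>0$, $\varepsilon_i\ge 0$, let $D_i:\Delta(\mathcal A_{-i})\times\Delta(\mathcal A_{-i})\to(-\infty,+\infty]$ be such that $D_i(\cdot,q)$ is bounded below and not identically $+\infty$ for every $q$, and let $\nu_i:\Delta(\mathcal A_i)\to(-\infty,+\infty]$ be bounded below and not identically $+\infty$. (Conventions: $0\cdot\infty=0$ and $\infty-\infty=-\infty$, so adversary strategies with infinite penalty are never used.) *Stage games.* For a pair $\mathbf R=(R_1,R_2)$ of real payoff matrices on $\mathcal A_1\times\mathcal A_2$, with the rows of $R_i$ indexed by player $i$'s own action, put $$f_i(\pi_i,\pi_{-i};\mathbf R)=\sup_{p_i\in\Delta(\mathcal A_{-i})}\Big\{-\pi_i^{T}R_ip_i-\tfrac1{\tau_i}D_i(p_i,\pi_{-i})+\varepsilon_i\nu_i(\pi_i)\Big\}.$$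 A pair $(\pi_1^*,\pi_2^*)\in\Delta(\mathcal A_1)\times\Delta(\mathcal A_2)$ is an RQE (risk-averse quantal-response equilibrium) of $\mathbf R$ if $f_i(\pi_i^*,\pi_{-i}^*;\mathbf R)\le f_i(\pi_i,\pi_{-i}^*;\mathbf R)$ for all $\pi_i\in\Delta(\mathcal A_i)$ and both $i$. If the RQE is unique, $\mathrm{RQE}_i(\mathbf R):=f_i(\pi_i^*,\pi_{-i}^*;\mathbf R)$. *Markov game.* For Markov policies $\pi_i:\mathcal S\to\Delta(\mathcal A_i)$ and adversary policies $p_i:\mathcal S\to\Delta(\mathcal A_{-i})$ let $$V_i^{\pi,p}(s)=\mathbb E_{s_0=s}\sum_{t\ge0}\gamma^t\Big(-r_i(s_t,\mathbf a_t)-\tfrac1{\tau_i}D_i\big(p_i(\cdot|s_t),\pi_{-i}(\cdot|s_t)\big)+\varepsilon_i\nu_i\big(\pi_i(\cdot|s_t)\big)\Big),$$ where in $\mathbf a_t$ the action of player $i$ is drawn from $\pi_i(\cdot|s_t)$ and, independently, that of player $-i$ from $p_i(\cdot|s_t)$, and $s_{t+1}\sim P(\cdot|s_t,\mathbf a_t)$;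 let $$Q_i^{\pi,p}(s,\mathbf a)=-r_i(s,\mathbf a)+\gamma\,\mathbb E_{s'\sim P(\cdot|s,\mathbf a)}V_i^{\pi,p}(s'),\qquad f_i(\pi_i,\pi_{-i};s)=\sup_{p_i}V_i^{\pi,p}(s).$$ A pair of Markov policies $\pi^*=(\pi_1^*,\pi_2^*)$ is a (stationary Markov) RQE of $\mathcal{MG}$ if $f_i(\pi_i^*,\pi_{-i}^*;s)\le f_i(\pi_i,\pi_{-i}^*;s)$ for all $s\in\mathcal S$, all $\pi_i:\mathcal S\to\Delta(\mathcal A_i)$ and both $i$. For a pair $\mathbf Q=(Q_1,Q_2)$ of functions $Q_i:\mathcal S\times\mathcal A_1\times\mathcal A_2\to\mathbb R$ such that for every $s$ the stage game with payoffs $-\mathbf Q(s,\cdot)$ has a unique RQE, the Bellman optimality operator is $$(\mathcal T\mathbf Q)_i(s,\mathbf a)=-r_i(s,\mathbf a)+\gamma\,\mathbb E_{s'\sim P(\cdot|s,\mathbf a)}\big[\mathrm{RQE}_i(-\mathbf Q(s',\cdot))\big].$$ **Proposition.** (1) Let $\mathbf Q^*$ be such that for every $s$ the stage game $-\mathbf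 Q^*(s,\cdot)$ has a unique RQE, and let $\mathcal T\mathbf Q^*=\mathbf Q^*$. Let $\pi^*$ be given by the stage-game minimax policies, that is, for every $s$ and both $i$, $$\pi_i^*(\cdot|s)\in\arg\min_{\pi_i\in\Delta(\mathcal A_i)}\ \sup_{p_i\in\Delta(\mathcal A_{-i})}\ \pi_i^{T}Q_i^*(s,\cdot)p_i-\tfrac1{\tau_i}D_i\big(p_i,\pi_{-i}^*(\cdot|s)\big)+\varepsilon_i\nu_i(\pi_i).$$ Then $\pi^*$ is an RQE of $\mathcal{MG}$. (2) Conversely, let $\pi^*$ be an RQE of $\mathcal{MG}$ and let $p^*=(p_1^*,p_2^*)$ be best-response adversary policies, that is, for both $i$ the policy $p_i^*$ maximizes $p_i\mapsto V_i^{\pi^*,p}(s)$ over all $p_i:\mathcal S\to\Delta(\mathcal A_{-i})$ for all $s\in\mathcal S$ simultaneously. Then all values $V_i^{\pi^*,p^*}(s)$ are finite, and if for every $s$ the stage game $-\mathbf Q^{\pi^*,p^*}(s,\cdot)$ has a unique RQE, then $\mathcal T\mathbf Q^{\pi^*,p^*}=\mathbf Q^{\pi^*,p^*}$. -/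

import Mathlib

open scoped ENNReal

/-- The behavioural primitives of a player with action set `X` facing an opponent with action set
`Y`: the penalty `D(p, q)` paid by the imagined adversary for using `p` instead of the opponent's
actual mixed strategy `q`, the regularizer `ν` of the player's own mixed strategy, the degree of
risk aversion `τ` and the temperature `ε`. Both `D` and `ν` may take the value `+∞` (as the
Kullback-Leibler divergence and the log-barrier do). As usual for penalty functions of convex risk
measures, each `D(·, q)` is bounded below and not identically `+∞`; so is `ν` (every proper convex
function on a simplex has these two properties). -/
structure Preferences (X Y : Type*) [Fintype X] [Fintype Y] where
  D : stdSimplex ℝ Y → stdSimplex ℝ Y → EReal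
  ν : stdSimplex ℝ X → EReal
  τ : ℝ
  ε : ℝ
  τ_pos : 0 < τ
  ε_nonneg : 0 ≤ ε
  D_bddBelow : ∀ q, ∃ c : ℝ, ∀ p, (c : EReal) ≤ D p q
  D_proper : ∀ q, ∃ p, D p q ≠ ⊤
  ν_bddBelow : ∃ c : ℝ, ∀ x, (c : EReal) ≤ ν x
  ν_proper : ∃ x, ν x ≠ ⊤

namespace Preferences

variable {X Y : Type*} [Fintype X] [Fintype Y]

/-- The normal-form objective `J(x, q, p; R) = - xᵀ R p - D(p, q) / τ + ε ν(x)` (to be minimized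
by the player and maximized by the adversary). The payoff matrix `R` is indexed by the player's own
action first. In `EReal` one has `⊥ + ⊤ = ⊥`: an adversary strategy with infinite penalty has
value `-∞`, so it never contributes to the supremum over adversaries. -/
noncomputable def objective (k : Preferences X Y) (R : X → Y → ℝ)
    (x : stdSimplex ℝ X) (q p : stdSimplex ℝ Y) : EReal :=
  ((-∑ a, ∑ b, x a * R a b * p b : ℝ) : EReal) - k.D p q / (k.τ : EReal) + (k.ε : EReal) * k.ν x

/-- The risk-averse regularized objective `f(x, q; R) = sup_p J(x, q, p; R)`. -/
noncomputable def riskObjective (k : Preferences X Y) (R : X → Y → ℝ)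
    (x : stdSimplex ℝ X) (q : stdSimplex ℝ Y) : EReal :=
  ⨆ p : stdSimplex ℝ Y, k.objective R x q p

end Preferences

section NormalForm

variable {A₁ A₂ : Type*} [Fintype A₁] [Fintype A₂]

/-- `z = (x₁, x₂)` is a risk-averse quantal-response equilibrium of the bimatrix game with payoff
matrices `R₁, R₂` (each indexed by the owner's action first). -/
def IsRQE (k₁ : Preferences A₁ A₂) (k₂ : Preferences A₂ A₁)
    (R₁ : A₁ → A₂ → ℝ) (R₂ : A₂ → A₁ → ℝ) (z : stdSimplex ℝ A₁ × stdSimplex ℝ A₂) : Prop :=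
  (∀ x, k₁.riskObjective R₁ z.1 z.2 ≤ k₁.riskObjective R₁ x z.2) ∧
  (∀ y, k₂.riskObjective R₂ z.2 z.1 ≤ k₂.riskObjective R₂ y z.1)

open Classical in
/-- The pair of values `(RQE₁(R), RQE₂(R))` of the two players at the unique RQE (a junk value if
there is no RQE or more than one). At an RQE both objectives are finite. -/
noncomputable def rqeValue (k₁ : Preferences A₁ A₂) (k₂ : Preferences A₂ A₁)
    (R₁ : A₁ → A₂ → ℝ) (R₂ : A₂ → A₁ → ℝ) : ℝ × ℝ :=
  if h : ∃! z, IsRQE k₁ k₂ R₁ R₂ z then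
    ((k₁.riskObjective R₁ h.choose.1 h.choose.2).toReal,
      (k₂.riskObjective R₂ h.choose.2 h.choose.1).toReal)
  else 0

end NormalForm

/-- A discounted two-player general-sum Markov game with finite state and action spaces. -/
structure MarkovGame (S A₁ A₂ : Type*) [Fintype S] where
  r₁ : S → A₁ → A₂ → ℝ
  r₂ : S → A₁ → A₂ → ℝ
  r₁_mem : ∀ s a b, r₁ s a b ∈ Set.Icc (0 : ℝ) 1
  r₂_mem : ∀ s a b, r₂ s a b ∈ Set.Icc (0 : ℝ) 1
  γ : ℝ
  γ_nonneg : 0 ≤ γ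
  γ_lt_one : γ < 1
  P : S → A₁ → A₂ → stdSimplex ℝ S
  ρ₀ : stdSimplex ℝ S

namespace MarkovGame

variable {S A₁ A₂ : Type*} [Fintype S] [Fintype A₁] [Fintype A₂]

/-- The same game with the names of the players exchanged. Single-player notions are defined below
for player 1; those of player 2 in `G` are the ones of player 1 in `G.swap`. -/
def swap (G : MarkovGame S A₁ A₂) : MarkovGame S A₂ A₁ where
  r₁ s b a := G.r₂ s a b
  r₂ s b a := G.r₁ s a b
  r₁_mem s b a := G.r₂_mem s a b
  r₂_mem s b a := G.r₁_mem s a b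
  γ := G.γ
  γ_nonneg := G.γ_nonneg
  γ_lt_one := G.γ_lt_one
  P s b a := G.P s a b
  ρ₀ := G.ρ₀

/-- The law of `s_t` when `s_0 = s₀` and the actions are drawn independently from `x(·|s_t)` and
`p(·|s_t)`. -/
noncomputable def stateLaw (G : MarkovGame S A₁ A₂) (x : S → stdSimplex ℝ A₁)
    (p : S → stdSimplex ℝ A₂) (s₀ : S) : ℕ → S → ℝ
  | 0 => ({s₀} : Set S).indicator fun _ => 1
  | t + 1 => fun s' =>
      ∑ s, ∑ a, ∑ b, stateLaw G x p s₀ t s * x s a * p s b * G.P s a b s'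

/-- The law of `(s_t, a_t, b_t)`. -/
noncomputable def stepLaw (G : MarkovGame S A₁ A₂) (x : S → stdSimplex ℝ A₁)
    (p : S → stdSimplex ℝ A₂) (s₀ : S) (t : ℕ) (s : S) (a : A₁) (b : A₂) : ℝ :=
  G.stateLaw x p s₀ t s * x s a * p s b

/-- `E[∑ₜ γᵗ g(s_t, a_t, b_t)]` for a nonnegative extended-valued `g`. -/
noncomputable def discountedSum (G : MarkovGame S A₁ A₂) (x : S → stdSimplex ℝ A₁)
    (p : S → stdSimplex ℝ A₂) (s₀ : S) (g : S → A₁ → A₂ → ℝ≥0∞) : ℝ≥0∞ :=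
  ∑' t : ℕ, ∑ s, ∑ a, ∑ b,
    ENNReal.ofReal (G.γ ^ t) * ENNReal.ofReal (G.stepLaw x p s₀ t s a b) * g s a b

/-- The cost `- r(s, a, b) - D(p(·|s), q(·|s)) / τ + ε ν(x(·|s))` of player 1 in one step. -/
noncomputable def stepCost (G : MarkovGame S A₁ A₂) (k : Preferences A₁ A₂)
    (x : S → stdSimplex ℝ A₁) (q p : S → stdSimplex ℝ A₂) (s : S) (a : A₁) (b : A₂) : EReal :=
  ((-G.r₁ s a b : ℝ) : EReal) - k.D (p s) (q s) / (k.τ : EReal) + (k.ε : EReal) * k.ν (x s)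

/-- The value `V(s₀) = E[∑ₜ γᵗ (- r - D / τ + ε ν)]` of player 1, who plays `x` against an opponent
whose policy is `q` while the adversary plays `p` (the second action is drawn from `p`). As for any
extended-valued integral it is the expectation of the positive part minus that of the negative
part; in `EReal` one has `⊤ - ⊤ = ⊥`, so that adversary policies with infinite expected penalty
have value `-∞`. -/
noncomputable def value (G : MarkovGame S A₁ A₂) (k : Preferences A₁ A₂)
    (x : S → stdSimplex ℝ A₁) (q p : S → stdSimplex ℝ A₂) (s₀ : S) : EReal :=
  (G.discountedSum x p s₀ fun s a b => (G.stepCost k x q p s a b).toENNReal : EReal) -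
    (G.discountedSum x p s₀ fun s a b => (-G.stepCost k x q p s a b).toENNReal : EReal)

/-- `f(x, q; s) = sup_p V^{x, q, p}(s)`, the supremum being over all Markov adversary policies. -/
noncomputable def riskValue (G : MarkovGame S A₁ A₂) (k : Preferences A₁ A₂)
    (x : S → stdSimplex ℝ A₁) (q : S → stdSimplex ℝ A₂) (s : S) : EReal :=
  ⨆ p : S → stdSimplex ℝ A₂, G.value k x q p s

/-- The `Q`-function of player 1, `Q(s, a, b) = - r(s, a, b) + γ E_{s' ∼ P(·|s, a, b)} V(s')`
(to be used where the values are finite). -/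
noncomputable def qValue (G : MarkovGame S A₁ A₂) (k : Preferences A₁ A₂)
    (x : S → stdSimplex ℝ A₁) (q p : S → stdSimplex ℝ A₂) (s : S) (a : A₁) (b : A₂) : ℝ :=
  -G.r₁ s a b + G.γ * ∑ s', G.P s a b s' * (G.value k x q p s').toReal

/-- Stationary Markov RQE: at every state no player can lower the risk-averse regularized
objective by switching to another Markov policy. -/
def IsMarkovRQE (G : MarkovGame S A₁ A₂) (k₁ : Preferences A₁ A₂) (k₂ : Preferences A₂ A₁)
    (π₁ : S → stdSimplex ℝ A₁) (π₂ : S → stdSimplex ℝ A₂) : Prop :=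
  (∀ s x, G.riskValue k₁ π₁ π₂ s ≤ G.riskValue k₁ x π₂ s) ∧
  (∀ s y, G.swap.riskValue k₂ π₂ π₁ s ≤ G.swap.riskValue k₂ y π₁ s)

/-- `p` is a best-response adversary policy of player 1: it maximizes `V^{x, q, p}(s)` for all
states `s` simultaneously. -/
def IsBestAdversary (G : MarkovGame S A₁ A₂) (k : Preferences A₁ A₂)
    (x : S → stdSimplex ℝ A₁) (q p : S → stdSimplex ℝ A₂) : Prop :=
  ∀ s p', G.value k x q p' s ≤ G.value k x q p s

/-- Pairs of `Q`-functions; each is indexed by the owner's action first. -/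
abbrev QPair (S A₁ A₂ : Type*) := (S → A₁ → A₂ → ℝ) × (S → A₂ → A₁ → ℝ)

/-- The stage game with payoff matrices `-Q₁(s, ·), -Q₂(s, ·)` has exactly one RQE. -/
def HasUniqueStageRQE (k₁ : Preferences A₁ A₂) (k₂ : Preferences A₂ A₁)
    (Q : QPair S A₁ A₂) (s : S) : Prop :=
  ∃! z, IsRQE k₁ k₂ (-Q.1 s) (-Q.2 s) z

/-- The risk-averse quantal-response Bellman optimality operator. -/
noncomputable def bellman (G : MarkovGame S A₁ A₂) (k₁ : Preferences A₁ A₂)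
    (k₂ : Preferences A₂ A₁) (Q : QPair S A₁ A₂) : QPair S A₁ A₂ :=
  (fun s a b => -G.r₁ s a b +
      G.γ * ∑ s', G.P s a b s' * (rqeValue k₁ k₂ (-Q.1 s') (-Q.2 s')).1,
    fun s b a => -G.r₂ s a b +
      G.γ * ∑ s', G.P s a b s' * (rqeValue k₁ k₂ (-Q.1 s') (-Q.2 s')).2)

end MarkovGame

/-!
The two directions rest on comparing, for one player and a fixed policy of the opponent, the value
`V` of a pair (own policy `x`, adversary policy `p`) with an arbitrary guess `W : S → ℝ`. Let
`Q_W = - r + γ P W` be the `Q`-function with continuation values `W`. Conditioning on the first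
step (`discountedSum_eq`, an identity in `ℝ≥0∞`) gives, wherever `V` is finite,
`J(x(s), q(s), p(s); -Q_W(s, ·)) = V(s) + γ E[W(s') - V(s')]`
(`ValueFinite.objective_continuationQ`). The chain never leaves the set of states with finite `V`,
so a maximum principle on this set turns inequalities between the stage objective and `W` into
inequalities between `V` and `W`:

* if the stage objective is at most `W` at every state whatever the adversary does, then the
  risk-averse value of `x` is at most the stage objective (`riskValue_le_riskObjective`);
* if the adversary `p` attains at least `W - η` in every stage game, then `V` is at least the stage
  objective up to a multiple of `η` (`objective_le_value_add`). The slack `η` is needed because the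
  supremum over adversaries need not be attained.

For a fixed point of the Bellman operator, `W` is the vector of equilibrium values of the stage
games. The first bound applies to the stage-optimal policy and the second to every other policy,
whence optimality in the Markov game (`riskValue_le_of_stage`). For a Markov equilibrium, `W` is the
value itself, which is finite by comparison with a policy of finite regularization and an adversary
of finite penalty. An adversary or a player with a better choice in the stage game at one state
could change the stationary policy at that state alone; by the same two bounds this would be a
profitable deviation in the Markov game (`IsBestAdversary.riskObjective_eq`,
`IsBestAdversary.riskObjective_le`). So the equilibrium policies form a stage equilibrium with
values `W`, and by uniqueness these are the values used by the Bellman operator.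
-/

/-! ### The ingredients of a one-step cost -/

namespace Preferences

variable {X Y : Type*} [Fintype X] [Fintype Y] (k : Preferences X Y)

/-- The penalty term `D(p, q) / τ` of the objective. -/
noncomputable def penalty (p q : stdSimplex ℝ Y) : EReal := k.D p q / (k.τ : EReal)

/-- The regularization term `ε ν(x)` of the objective. -/
noncomputable def regularization (x : stdSimplex ℝ X) : EReal := (k.ε : EReal) * k.ν x

theorem exists_le_penalty (q : stdSimplex ℝ Y) : ∃ c : ℝ, ∀ p, (c : EReal) ≤ k.penalty p q := by
  obtain ⟨c, hc⟩ := k.D_bddBelow q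
  refine ⟨c / k.τ, fun p => ?_⟩
  rw [EReal.coe_div]
  exact EReal.div_le_div_right_of_nonneg (by exact_mod_cast k.τ_pos.le) (hc p)

theorem penalty_ne_bot (p q : stdSimplex ℝ Y) : k.penalty p q ≠ ⊥ := by
  obtain ⟨c, hc⟩ := k.exists_le_penalty q
  exact ne_bot_of_le_ne_bot (EReal.coe_ne_bot c) (hc p)

theorem regularization_ne_bot (x : stdSimplex ℝ X) : k.regularization x ≠ ⊥ := by
  obtain ⟨c, hc⟩ := k.ν_bddBelow
  refine ne_bot_of_le_ne_bot (EReal.coe_ne_bot (k.ε * c)) ?_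
  rw [EReal.coe_mul]
  exact mul_le_mul_of_nonneg_left (hc x) (by exact_mod_cast k.ε_nonneg)

theorem exists_penalty_ne_top (q : stdSimplex ℝ Y) : ∃ p, k.penalty p q ≠ ⊤ := by
  obtain ⟨p, hp⟩ := k.D_proper q
  obtain ⟨c, hc⟩ := k.D_bddBelow q
  have hb : k.D p q ≠ ⊥ := ne_bot_of_le_ne_bot (EReal.coe_ne_bot c) (hc p)
  refine ⟨p, ?_⟩
  unfold penalty
  rw [← EReal.coe_toReal hp hb, ← EReal.coe_div]
  exact EReal.coe_ne_top _

theorem exists_regularization_ne_top : ∃ x, k.regularization x ≠ ⊤ := by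
  obtain ⟨x, hx⟩ := k.ν_proper
  obtain ⟨c, hc⟩ := k.ν_bddBelow
  have hb : k.ν x ≠ ⊥ := ne_bot_of_le_ne_bot (EReal.coe_ne_bot c) (hc x)
  refine ⟨x, ?_⟩
  unfold regularization
  rw [← EReal.coe_toReal hx hb, ← EReal.coe_mul]
  exact EReal.coe_ne_top _

theorem objective_eq (R : X → Y → ℝ) (x : stdSimplex ℝ X) (q p : stdSimplex ℝ Y) :
    k.objective R x q p = ((-∑ a, ∑ b, x a * R a b * p b : ℝ) : EReal) - k.penalty p q
      + k.regularization x := rfl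

end Preferences

namespace EReal

theorem coe_sub_add_ne_bot_iff {c : ℝ} {A B : EReal} (hA : A ≠ ⊥) (hB : B ≠ ⊥) :
    (c : EReal) - A + B ≠ ⊥ ↔ A ≠ ⊤ := by
  induction A with
  | bot => exact absurd rfl hA
  | top => simp
  | coe A =>
    rw [← EReal.coe_sub]
    simp [hB, EReal.add_eq_bot_iff, -EReal.coe_sub]

theorem coe_sub_add_ne_top {c : ℝ} {A B : EReal} (hA : A ≠ ⊥) (hB : B ≠ ⊤) :
    (c : EReal) - A + B ≠ ⊤ := by
  refine EReal.add_ne_top ?_ hB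
  induction A with
  | bot => exact absurd rfl hA
  | top => simp
  | coe A => rw [← EReal.coe_sub]; exact EReal.coe_ne_top _

theorem ne_top_of_coe_sub_add_ne_top {c : ℝ} {A B : EReal} (hA : A ≠ ⊥) (hA' : A ≠ ⊤)
    (h : (c : EReal) - A + B ≠ ⊤) : B ≠ ⊤ := by
  rintro rfl
  lift A to ℝ using ⟨hA', hA⟩
  exact h (by rw [← EReal.coe_sub, EReal.coe_add_top])

end EReal

namespace Preferences

variable {X Y : Type*} [Fintype X] [Fintype Y] (k : Preferences X Y)

theorem objective_ne_bot_iff {R : X → Y → ℝ} {x : stdSimplex ℝ X} {q p : stdSimplex ℝ Y} :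
    k.objective R x q p ≠ ⊥ ↔ k.penalty p q ≠ ⊤ :=
  EReal.coe_sub_add_ne_bot_iff (k.penalty_ne_bot p q) (k.regularization_ne_bot x)

theorem riskObjective_ne_bot (R : X → Y → ℝ) (x : stdSimplex ℝ X) (q : stdSimplex ℝ Y) :
    k.riskObjective R x q ≠ ⊥ := by
  obtain ⟨p, hp⟩ := k.exists_penalty_ne_top q
  exact ne_bot_of_le_ne_bot (k.objective_ne_bot_iff.2 hp)
    (le_iSup (fun p => k.objective R x q p) p)

theorem regularization_ne_top_of_riskObjective_ne_top {R : X → Y → ℝ} {x : stdSimplex ℝ X}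
    {q : stdSimplex ℝ Y} (h : k.riskObjective R x q ≠ ⊤) : k.regularization x ≠ ⊤ := by
  obtain ⟨p, hp⟩ := k.exists_penalty_ne_top q
  exact EReal.ne_top_of_coe_sub_add_ne_top (k.penalty_ne_bot p q) hp
    (ne_top_of_le_ne_top h (le_iSup (fun p => k.objective R x q p) p))

theorem sum_sum_mul_mul_le {R : X → Y → ℝ} {m : ℝ} (h : ∀ a b, R a b ≤ m) (x : stdSimplex ℝ X)
    (p : stdSimplex ℝ Y) : ∑ a, ∑ b, x a * R a b * p b ≤ m := by
  calc ∑ a, ∑ b, x a * R a b * p b ≤ ∑ a, ∑ b, x a * m * p b := by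
        gcongr with a _ b _
        · exact p.2.1 b
        · exact x.2.1 a
        · exact h a b
    _ = m := by
        simp [← Finset.mul_sum, ← Finset.sum_mul]

/-- The bound is affine in the payoffs, uniformly over the adversaries: the penalty is bounded
below. -/
theorem exists_riskObjective_le {x : stdSimplex ℝ X} (q : stdSimplex ℝ Y)
    (hx : k.regularization x ≠ ⊤) :
    ∃ C : ℝ, ∀ (R : X → Y → ℝ) (m : ℝ), (∀ a b, -R a b ≤ m) →
      k.riskObjective R x q ≤ ((C + m : ℝ) : EReal) := by
  obtain ⟨c, hc⟩ := k.exists_le_penalty q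
  refine ⟨-c + (k.regularization x).toReal, fun R m hm => iSup_le fun p => ?_⟩
  have h1 : (-∑ a, ∑ b, x a * R a b * p b : ℝ) ≤ m := by
    have := sum_sum_mul_mul_le (R := fun a b => -R a b) hm x p
    simpa using this
  rw [k.objective_eq, ← EReal.coe_toReal hx (k.regularization_ne_bot x)]
  calc _ ≤ (m : EReal) - (c : EReal) + ((k.regularization x).toReal : EReal) := by
        gcongr
        exact EReal.sub_le_sub (by exact_mod_cast h1) (hc p)
    _ = _ := by
        rw [← EReal.coe_sub, ← EReal.coe_add]
        congr 1
        simp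
        ring

theorem riskObjective_ne_top {x : stdSimplex ℝ X} (hx : k.regularization x ≠ ⊤)
    (R : X → Y → ℝ) (q : stdSimplex ℝ Y) : k.riskObjective R x q ≠ ⊤ := by
  obtain ⟨C, hC⟩ := k.exists_riskObjective_le q hx
  obtain ⟨m, hm⟩ := (Set.finite_range fun z : X × Y => -R z.1 z.2).bddAbove
  exact ne_top_of_le_ne_top (EReal.coe_ne_top _)
    (hC R m fun a b => hm (Set.mem_range_self (a, b)))

end Preferences

namespace MarkovGame

variable {S A₁ A₂ : Type*} [Fintype S] [Fintype A₁] [Fintype A₂]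
variable (G : MarkovGame S A₁ A₂)

/-! ### The first-step recursion -/

/-- The transition matrix of the Markov chain of states under the policies `x` and `p`. -/
noncomputable def transition (x : S → stdSimplex ℝ A₁) (p : S → stdSimplex ℝ A₂) :
    Matrix S S ℝ :=
  Matrix.of fun s s' => ∑ a, ∑ b, x s a * p s b * G.P s a b s'

variable (x : S → stdSimplex ℝ A₁) (q p : S → stdSimplex ℝ A₂)

theorem transition_apply (s s' : S) :
    G.transition x p s s' = ∑ a, ∑ b, x s a * p s b * G.P s a b s' := rfl

theorem transition_nonneg (s s' : S) : 0 ≤ G.transition x p s s' :=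
  Finset.sum_nonneg fun a _ => Finset.sum_nonneg fun b _ =>
    mul_nonneg (mul_nonneg ((x s).2.1 a) ((p s).2.1 b)) ((G.P s a b).2.1 s')

theorem sum_transition_mul (W : S → ℝ) (s : S) :
    ∑ s', G.transition x p s s' * W s' =
      ∑ a, ∑ b, x s a * p s b * ∑ s', G.P s a b s' * W s' := by
  simp only [transition_apply, Finset.sum_mul, Finset.mul_sum]
  rw [Finset.sum_comm]
  refine Finset.sum_congr rfl fun a _ => ?_
  rw [Finset.sum_comm]
  simp only [mul_assoc]

theorem sum_transition (s : S) : ∑ s', G.transition x p s s' = 1 := by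
  have h := G.sum_transition_mul x p (fun _ => 1) s
  simpa [← Finset.mul_sum] using h

theorem transition_mem_rowStochastic [DecidableEq S] :
    G.transition x p ∈ Matrix.rowStochastic ℝ S :=
  Matrix.mem_rowStochastic_iff_sum.2 ⟨G.transition_nonneg x p, G.sum_transition x p⟩

theorem stateLaw_eq_pow [DecidableEq S] (s₀ : S) (t : ℕ) (s : S) :
    G.stateLaw x p s₀ t s = (G.transition x p ^ t) s₀ s := by
  induction t generalizing s with
  | zero =>
    simp only [stateLaw, pow_zero, Matrix.one_apply, Set.indicator_apply, Set.mem_singleton_iff,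
      eq_comm]
  | succ t ih =>
    simp only [stateLaw, ih, pow_succ, Matrix.mul_apply, transition_apply, Finset.mul_sum,
      mul_assoc]

theorem stateLaw_nonneg (s₀ : S) (t : ℕ) (s : S) : 0 ≤ G.stateLaw x p s₀ t s := by
  classical
  rw [stateLaw_eq_pow]
  exact Matrix.nonneg_of_mem_rowStochastic
    (pow_mem (G.transition_mem_rowStochastic x p) t)

theorem stateLaw_le_one (s₀ : S) (t : ℕ) (s : S) : G.stateLaw x p s₀ t s ≤ 1 := by
  classical
  rw [stateLaw_eq_pow]
  exact Matrix.le_one_of_mem_rowStochastic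
    (pow_mem (G.transition_mem_rowStochastic x p) t)

/-- The Markov property: the chain observed from time `1` on restarts at `s_1`. -/
theorem stateLaw_succ (s₀ : S) (t : ℕ) (s : S) :
    G.stateLaw x p s₀ (t + 1) s =
      ∑ s₁, G.transition x p s₀ s₁ * G.stateLaw x p s₁ t s := by
  classical
  simp only [stateLaw_eq_pow, pow_succ', Matrix.mul_apply]

theorem stepLaw_nonneg (s₀ : S) (t : ℕ) (s : S) (a : A₁) (b : A₂) :
    0 ≤ G.stepLaw x p s₀ t s a b :=
  mul_nonneg (mul_nonneg (G.stateLaw_nonneg x p s₀ t s) ((x s).2.1 a)) ((p s).2.1 b)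

theorem stepLaw_le_one (s₀ : S) (t : ℕ) (s : S) (a : A₁) (b : A₂) :
    G.stepLaw x p s₀ t s a b ≤ 1 :=
  mul_le_one₀ (mul_le_one₀ (G.stateLaw_le_one x p s₀ t s) ((x s).2.1 a) (stdSimplex.le_one _ a))
    ((p s).2.1 b) (stdSimplex.le_one _ b)

theorem stepLaw_zero_self (s : S) (a : A₁) (b : A₂) :
    G.stepLaw x p s 0 s a b = x s a * p s b := by
  simp [stepLaw, stateLaw]

theorem stepLaw_zero_of_ne {s₀ s : S} (h : s ≠ s₀) (a : A₁) (b : A₂) :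
    G.stepLaw x p s₀ 0 s a b = 0 := by
  simp [stepLaw, stateLaw, h]

theorem stepLaw_succ (s₀ : S) (t : ℕ) (s : S) (a : A₁) (b : A₂) :
    G.stepLaw x p s₀ (t + 1) s a b =
      ∑ s₁, G.transition x p s₀ s₁ * G.stepLaw x p s₁ t s a b := by
  simp only [stepLaw, stateLaw_succ, Finset.sum_mul, mul_assoc]

/-- Holds without any finiteness assumption, all terms being nonnegative. -/
theorem discountedSum_eq (g : S → A₁ → A₂ → ℝ≥0∞) (s₀ : S) :
    G.discountedSum x p s₀ g =
      ∑ a, ∑ b, ENNReal.ofReal (x s₀ a * p s₀ b) * g s₀ a b +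
      ∑ s₁, ENNReal.ofReal (G.γ * G.transition x p s₀ s₁) * G.discountedSum x p s₁ g := by
  have hγ := G.γ_nonneg
  have hstep : ∀ t s a b,
      ENNReal.ofReal (G.γ ^ (t + 1)) * ENNReal.ofReal (G.stepLaw x p s₀ (t + 1) s a b) * g s a b =
      ∑ s₁, ENNReal.ofReal (G.γ * G.transition x p s₀ s₁) *
        (ENNReal.ofReal (G.γ ^ t) * ENNReal.ofReal (G.stepLaw x p s₁ t s a b) * g s a b) := by
    intro t s a b
    simp only [← mul_assoc]
    rw [← Finset.sum_mul, ← ENNReal.ofReal_mul (by positivity), stepLaw_succ, Finset.mul_sum,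
      ENNReal.ofReal_sum_of_nonneg]
    · congr 1
      refine Finset.sum_congr rfl fun s₁ _ => ?_
      have hK := G.transition_nonneg x p s₀ s₁
      rw [← ENNReal.ofReal_mul (by positivity), ← ENNReal.ofReal_mul (by positivity)]
      congr 1
      ring
    · intro s₁ _
      exact mul_nonneg (by positivity)
        (mul_nonneg (G.transition_nonneg x p s₀ s₁) (G.stepLaw_nonneg x p s₁ t s a b))
  rw [discountedSum, tsum_eq_zero_add' ENNReal.summable]
  congr 1
  · rw [Finset.sum_eq_single_of_mem s₀ (Finset.mem_univ _)]
    · simp [stepLaw_zero_self]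
    · intro s _ hs
      simp [stepLaw_zero_of_ne G x p hs]
  · simp only [hstep, discountedSum, ← ENNReal.tsum_mul_left]
    rw [← Summable.tsum_finsetSum fun _ _ => ENNReal.summable]
    refine tsum_congr fun t => ?_
    simp only [Finset.mul_sum]
    symm
    rw [Finset.sum_comm]
    refine Finset.sum_congr rfl fun s _ => ?_
    rw [Finset.sum_comm]
    refine Finset.sum_congr rfl fun a _ => ?_
    rw [Finset.sum_comm]

theorem discountedSum_ne_top {g : S → A₁ → A₂ → ℝ≥0∞} (hg : ∀ s a b, g s a b ≠ ⊤) (s₀ : S) :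
    G.discountedSum x p s₀ g ≠ ⊤ := by
  have hγ : ∑' t : ℕ, ENNReal.ofReal (G.γ ^ t) ≠ ⊤ := by
    simp only [ENNReal.ofReal_pow G.γ_nonneg, ENNReal.tsum_geometric]
    exact ENNReal.inv_ne_top.2 (tsub_pos_of_lt (by simpa using G.γ_lt_one)).ne'
  have hle : G.discountedSum x p s₀ g ≤
      (∑' t : ℕ, ENNReal.ofReal (G.γ ^ t)) * ∑ s, ∑ a, ∑ b, g s a b := by
    rw [discountedSum, ← ENNReal.tsum_mul_right]
    refine ENNReal.tsum_le_tsum fun t => ?_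
    simp only [Finset.mul_sum, mul_assoc]
    gcongr with s _ a _ b _
    exact mul_le_of_le_one_left' (by simpa using G.stepLaw_le_one x p s₀ t s a b)
  refine ne_top_of_le_ne_top (ENNReal.mul_ne_top hγ ?_) hle
  simp [ENNReal.sum_eq_top, hg]

end MarkovGame

/-! ### Bellman's equation for fixed policies -/

namespace EReal

theorem coe_ennreal_sub_ne_bot_iff {P N : ℝ≥0∞} : (P : EReal) - N ≠ ⊥ ↔ N ≠ ⊤ := by
  induction N with
  | top => simp
  | coe N =>
    have : (P : EReal) - ((N : ℝ) : EReal) ≠ ⊥ := by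
      rw [sub_eq_add_neg, ← EReal.coe_neg]
      simp [EReal.add_eq_bot_iff, -EReal.coe_neg]
    exact iff_of_true this ENNReal.coe_ne_top

theorem coe_ennreal_sub_ne_top {P N : ℝ≥0∞} (hP : P ≠ ⊤) : (P : EReal) - N ≠ ⊤ := by
  rw [sub_eq_add_neg]
  refine EReal.add_ne_top (by simpa using hP) ?_
  simp

theorem ne_top_of_coe_ennreal_sub_ne_top {P N : ℝ≥0∞} (hN : N ≠ ⊤)
    (h : (P : EReal) - N ≠ ⊤) : P ≠ ⊤ := by
  rintro rfl
  lift N to NNReal using hN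
  exact h (EReal.top_sub_coe N)

theorem toReal_coe_ennreal_sub {P N : ℝ≥0∞} (hP : P ≠ ⊤) (hN : N ≠ ⊤) :
    ((P : EReal) - N).toReal = P.toReal - N.toReal := by
  rw [EReal.toReal_sub (by simpa using hP) (by simp) (by simpa using hN) (by simp),
    EReal.toReal_coe_ennreal, EReal.toReal_coe_ennreal]

end EReal

namespace MarkovGame

variable {S A₁ A₂ : Type*} [Fintype S] [Fintype A₁] [Fintype A₂]
variable (G : MarkovGame S A₁ A₂)
variable {x : S → stdSimplex ℝ A₁} {q p : S → stdSimplex ℝ A₂} {k : Preferences A₁ A₂}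

theorem toReal_discountedSum {g : S → A₁ → A₂ → ℝ≥0∞} {s₀ : S}
    (h : G.discountedSum x p s₀ g ≠ ⊤) :
    (G.discountedSum x p s₀ g).toReal =
      ∑ a, ∑ b, x s₀ a * p s₀ b * (g s₀ a b).toReal +
      G.γ * ∑ s₁, G.transition x p s₀ s₁ * (G.discountedSum x p s₁ g).toReal := by
  rw [discountedSum_eq] at h ⊢
  obtain ⟨h1, h2⟩ := ENNReal.add_ne_top.1 h
  rw [ENNReal.toReal_add h1 h2]
  rw [ENNReal.sum_ne_top] at h1 h2
  congr 1
  · rw [ENNReal.toReal_sum h1]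
    refine Finset.sum_congr rfl fun a ha => ?_
    rw [ENNReal.toReal_sum (ENNReal.sum_ne_top.1 (h1 a ha))]
    refine Finset.sum_congr rfl fun b _ => ?_
    rw [ENNReal.toReal_mul, ENNReal.toReal_ofReal
      (mul_nonneg (stdSimplex.zero_le _ a) (stdSimplex.zero_le _ b))]
  · rw [ENNReal.toReal_sum h2, Finset.mul_sum]
    refine Finset.sum_congr rfl fun s₁ _ => ?_
    rw [ENNReal.toReal_mul, ENNReal.toReal_ofReal
      (mul_nonneg G.γ_nonneg (G.transition_nonneg x p s₀ s₁)), mul_assoc]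

theorem discountedSum_ne_top_of_transition {g : S → A₁ → A₂ → ℝ≥0∞} {s₀ s₁ : S}
    (h : G.discountedSum x p s₀ g ≠ ⊤) (hs : G.γ * G.transition x p s₀ s₁ ≠ 0) :
    G.discountedSum x p s₁ g ≠ ⊤ := by
  rw [discountedSum_eq] at h
  have h2 := ENNReal.sum_ne_top.1 (ENNReal.add_ne_top.1 h).2 s₁ (Finset.mem_univ _)
  have hpos : 0 < G.γ * G.transition x p s₀ s₁ :=
    lt_of_le_of_ne (mul_nonneg G.γ_nonneg (G.transition_nonneg x p s₀ s₁)) hs.symm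
  intro htop
  rw [htop, ENNReal.mul_top (by simpa using hpos)] at h2
  exact h2 rfl

theorem _root_.stdSimplex.exists_pos {X : Type*} [Fintype X] (y : stdSimplex ℝ X) :
    ∃ a, 0 < y a := by
  by_contra! hy
  have := Finset.sum_nonpos fun a (_ : a ∈ Finset.univ) => hy a
  rw [stdSimplex.sum_eq_one] at this
  linarith

theorem exists_ne_top_of_discountedSum_ne_top {g : S → A₁ → A₂ → ℝ≥0∞} {s : S}
    (h : G.discountedSum x p s g ≠ ⊤) : ∃ a b, g s a b ≠ ⊤ := by
  obtain ⟨a, ha⟩ := stdSimplex.exists_pos (x s)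
  obtain ⟨b, hb⟩ := stdSimplex.exists_pos (p s)
  refine ⟨a, b, fun htop => ?_⟩
  rw [discountedSum_eq] at h
  have h1 := ENNReal.sum_ne_top.1 (ENNReal.sum_ne_top.1 (ENNReal.add_ne_top.1 h).1 a
    (Finset.mem_univ _)) b (Finset.mem_univ _)
  rw [htop, ENNReal.mul_top (ENNReal.ofReal_pos.2 (mul_pos ha hb)).ne'] at h1
  exact h1 rfl

theorem value_ne_bot_of_penalty_ne_top (h : ∀ s, k.penalty (p s) (q s) ≠ ⊤) (s : S) :
    G.value k x q p s ≠ ⊥ := by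
  refine EReal.coe_ennreal_sub_ne_bot_iff.2 (G.discountedSum_ne_top x p (fun s a b => ?_) s)
  rw [EReal.toENNReal_ne_top_iff, ne_eq, EReal.neg_eq_top_iff]
  exact (EReal.coe_sub_add_ne_bot_iff (k.penalty_ne_bot _ _) (k.regularization_ne_bot _)).2 (h s)

theorem value_ne_top_of_regularization_ne_top (h : ∀ s, k.regularization (x s) ≠ ⊤) (s : S) :
    G.value k x q p s ≠ ⊤ := by
  refine EReal.coe_ennreal_sub_ne_top (G.discountedSum_ne_top x p (fun s a b => ?_) s)
  rw [EReal.toENNReal_ne_top_iff]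
  exact EReal.coe_sub_add_ne_top (k.penalty_ne_bot _ _) (h s)

/-- The value at `s` is finite. -/
def ValueFinite (k : Preferences A₁ A₂) (x : S → stdSimplex ℝ A₁) (q p : S → stdSimplex ℝ A₂)
    (s : S) : Prop :=
  G.value k x q p s ≠ ⊤ ∧ G.value k x q p s ≠ ⊥

variable {G}

theorem ValueFinite.parts {s : S} (h : G.ValueFinite k x q p s) :
    (G.discountedSum x p s fun s a b => (G.stepCost k x q p s a b).toENNReal) ≠ ⊤ ∧
    (G.discountedSum x p s fun s a b => (-G.stepCost k x q p s a b).toENNReal) ≠ ⊤ := by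
  have hN := EReal.coe_ennreal_sub_ne_bot_iff.1 h.2
  exact ⟨EReal.ne_top_of_coe_ennreal_sub_ne_top hN h.1, hN⟩

theorem ValueFinite.of_transition {s s' : S} (h : G.ValueFinite k x q p s)
    (hs : G.γ * G.transition x p s s' ≠ 0) : G.ValueFinite k x q p s' :=
  ⟨EReal.coe_ennreal_sub_ne_top (G.discountedSum_ne_top_of_transition h.parts.1 hs),
    EReal.coe_ennreal_sub_ne_bot_iff.2 (G.discountedSum_ne_top_of_transition h.parts.2 hs)⟩

theorem ValueFinite.penalty_ne_top {s : S} (h : G.ValueFinite k x q p s) :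
    k.penalty (p s) (q s) ≠ ⊤ := by
  obtain ⟨a, b, hg⟩ := G.exists_ne_top_of_discountedSum_ne_top h.parts.2
  rw [EReal.toENNReal_ne_top_iff, ne_eq, EReal.neg_eq_top_iff] at hg
  exact (EReal.coe_sub_add_ne_bot_iff (k.penalty_ne_bot _ _) (k.regularization_ne_bot _)).1 hg

theorem ValueFinite.regularization_ne_top {s : S} (h : G.ValueFinite k x q p s) :
    k.regularization (x s) ≠ ⊤ := by
  obtain ⟨a, b, hg⟩ := G.exists_ne_top_of_discountedSum_ne_top h.parts.1
  rw [EReal.toENNReal_ne_top_iff] at hg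
  exact EReal.ne_top_of_coe_sub_add_ne_top (k.penalty_ne_bot _ _) h.penalty_ne_top hg

variable (G)

/-- The `Q`-function `Q(s, a, b) = - r(s, a, b) + γ E_{s' ∼ P(·|s, a, b)} W(s')` of player 1 for
the continuation values `W`. -/
noncomputable def continuationQ (W : S → ℝ) (s : S) (a : A₁) (b : A₂) : ℝ :=
  -G.r₁ s a b + G.γ * ∑ s', G.P s a b s' * W s'

variable {G}

/-- Bellman's equation for the value of a fixed pair of policies, written relative to an arbitrary
continuation value `W`. States with zero transition weight, where the value may be infinite,
do not contribute to the sum. -/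
theorem ValueFinite.objective_continuationQ (W : S → ℝ) {s : S} (h : G.ValueFinite k x q p s) :
    k.objective (-G.continuationQ W s) (x s) (q s) (p s) =
      (((G.value k x q p s).toReal + G.γ * ∑ s', G.transition x p s s' *
        (W s' - (G.value k x q p s').toReal) : ℝ) : EReal) := by
  obtain ⟨α, hα⟩ : ∃ α : ℝ, k.penalty (p s) (q s) = α :=
    ⟨_, (EReal.coe_toReal h.penalty_ne_top (k.penalty_ne_bot _ _)).symm⟩
  obtain ⟨β, hβ⟩ : ∃ β : ℝ, k.regularization (x s) = β :=
    ⟨_, (EReal.coe_toReal h.regularization_ne_top (k.regularization_ne_bot _)).symm⟩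
  have hcost : ∀ a b, G.stepCost k x q p s a b = ((-G.r₁ s a b - α + β : ℝ) : EReal) := by
    intro a b
    have : G.stepCost k x q p s a b = ((-G.r₁ s a b : ℝ) : EReal) - k.penalty (p s) (q s) +
      k.regularization (x s) := rfl
    rw [this, hα, hβ, ← EReal.coe_sub, ← EReal.coe_add]
  have hval : (G.value k x q p s).toReal =
      ∑ a, ∑ b, x s a * p s b * (-G.r₁ s a b - α + β) +
      G.γ * ∑ s', G.transition x p s s' * (G.value k x q p s').toReal := by
    rw [value, EReal.toReal_coe_ennreal_sub h.parts.1 h.parts.2,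
      toReal_discountedSum G h.parts.1, toReal_discountedSum G h.parts.2, add_sub_add_comm]
    congr 1
    · simp only [← Finset.sum_sub_distrib, ← mul_sub, hcost, ← EReal.coe_neg,
        EReal.real_coe_toENNReal, ENNReal.toReal_ofReal']
      refine Finset.sum_congr rfl fun a _ => Finset.sum_congr rfl fun b _ => ?_
      rw [max_zero_sub_max_neg_zero_eq_self]
    · rw [← mul_sub, ← Finset.sum_sub_distrib, Finset.mul_sum, Finset.mul_sum]
      refine Finset.sum_congr rfl fun s' _ => ?_
      rw [← mul_sub, ← mul_assoc, ← mul_assoc]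
      by_cases hs : G.γ * G.transition x p s s' = 0
      · simp [hs]
      · have h' := h.of_transition hs
        rw [value, EReal.toReal_coe_ennreal_sub h'.parts.1 h'.parts.2]
  have hone : ∑ a, ∑ b, x s a * p s b * (-α + β) = -α + β := by
    simp [← Finset.sum_mul, ← Finset.mul_sum]
  rw [k.objective_eq, hα, hβ, ← EReal.coe_sub, ← EReal.coe_add]
  congr 1
  have hpay : -∑ a, ∑ b, x s a * (-G.continuationQ W s) a b * p s b =
      ∑ a, ∑ b, x s a * p s b * (-G.r₁ s a b - α + β) - (-α + β) +
      G.γ * ∑ s', G.transition x p s s' * W s' := by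
    rw [sum_transition_mul G x p W, ← hone, ← Finset.sum_sub_distrib, Finset.mul_sum,
      ← Finset.sum_add_distrib, ← Finset.sum_neg_distrib]
    refine Finset.sum_congr rfl fun a _ => ?_
    rw [← Finset.sum_sub_distrib, Finset.mul_sum, ← Finset.sum_add_distrib,
      ← Finset.sum_neg_distrib]
    refine Finset.sum_congr rfl fun b _ => ?_
    simp only [Pi.neg_apply, continuationQ]
    ring
  have hsub : ∑ s', G.transition x p s s' * (W s' - (G.value k x q p s').toReal) =
      ∑ s', G.transition x p s s' * W s' -
      ∑ s', G.transition x p s s' * (G.value k x q p s').toReal := by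
    rw [← Finset.sum_sub_distrib]
    exact Finset.sum_congr rfl fun s' _ => mul_sub _ _ _
  rw [hpay, hsub, hval]
  ring

end MarkovGame

namespace MarkovGame

variable {S A₁ A₂ : Type*} [Fintype S] [Fintype A₁] [Fintype A₂]
variable {G : MarkovGame S A₁ A₂}
variable {x : S → stdSimplex ℝ A₁} {q p : S → stdSimplex ℝ A₂} {k : Preferences A₁ A₂}

/-! ### Comparison with the value -/

theorem discounted_sum_transition_le {d : S → ℝ} {c : ℝ}
    (hd : ∀ s, G.ValueFinite k x q p s → d s ≤ c) {s : S} (hs : G.ValueFinite k x q p s) :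
    G.γ * ∑ s', G.transition x p s s' * d s' ≤ G.γ * c := by
  calc G.γ * ∑ s', G.transition x p s s' * d s'
      = ∑ s', G.γ * G.transition x p s s' * d s' := by simp only [Finset.mul_sum, mul_assoc]
    _ ≤ ∑ s', G.γ * G.transition x p s s' * c := by
        refine Finset.sum_le_sum fun s' _ => ?_
        by_cases h0 : G.γ * G.transition x p s s' = 0
        · simp [h0]
        · exact mul_le_mul_of_nonneg_left (hd s' (hs.of_transition h0))
            (mul_nonneg G.γ_nonneg (G.transition_nonneg x p s s'))
    _ = G.γ * c := by
        rw [← Finset.sum_mul, ← Finset.mul_sum, sum_transition, mul_one]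

/-- Maximum principle on the set of states where the value is finite, which the chain never
leaves. -/
theorem le_of_forall_le_add_transition {d : S → ℝ} {η : ℝ}
    (hd : ∀ s, G.ValueFinite k x q p s → d s ≤ η + G.γ * ∑ s', G.transition x p s s' * d s')
    {s : S} (hs : G.ValueFinite k x q p s) : d s ≤ η / (1 - G.γ) := by
  classical
  obtain ⟨m, hm, hmax⟩ := Finset.exists_max_image
    (Finset.univ.filter fun s => G.ValueFinite k x q p s) d ⟨s, by simpa using hs⟩
  simp only [Finset.mem_filter, Finset.mem_univ, true_and] at hm hmax
  refine (hmax s hs).trans ?_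
  rw [le_div_iff₀ (sub_pos.2 G.γ_lt_one)]
  linarith [hd m hm, discounted_sum_transition_le hmax hm]

theorem riskValue_le_riskObjective {W : S → ℝ}
    (hW : ∀ s, k.riskObjective (-G.continuationQ W s) (x s) (q s) ≤ W s) (s : S) :
    G.riskValue k x q s ≤ k.riskObjective (-G.continuationQ W s) (x s) (q s) := by
  refine iSup_le fun p => ?_
  have hreg : ∀ s, k.regularization (x s) ≠ ⊤ := fun s =>
    k.regularization_ne_top_of_riskObjective_ne_top
      (ne_top_of_le_ne_top (EReal.coe_ne_top _) (hW s))
  have htop := G.value_ne_top_of_regularization_ne_top (q := q) (p := p) hreg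
  by_cases hbot : G.value k x q p s = ⊥
  · simp [hbot]
  have hs : G.ValueFinite k x q p s := ⟨htop s, hbot⟩
  have hle : ∀ s, G.ValueFinite k x q p s → (G.value k x q p s).toReal - W s ≤ 0 := by
    intro s hs
    have := le_of_forall_le_add_transition (d := fun s => (G.value k x q p s).toReal - W s)
      (η := 0) (fun s hs => ?_) hs
    · simpa using this
    have h1 := (le_iSup (fun p => k.objective (-G.continuationQ W s) (x s) (q s) p) (p s)).trans
      (hW s)
    rw [hs.objective_continuationQ W, EReal.coe_le_coe_iff] at h1
    simp only [← neg_sub (W _), mul_neg, Finset.sum_neg_distrib]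
    linarith
  have hmono := discounted_sum_transition_le hle hs
  simp only [← neg_sub (W _), mul_neg, Finset.sum_neg_distrib] at hmono
  refine le_trans ?_
    (le_iSup (fun p => k.objective (-G.continuationQ W s) (x s) (q s) p) (p s))
  rw [hs.objective_continuationQ W, ← EReal.coe_toReal hs.1 hs.2, EReal.coe_le_coe_iff,
    EReal.toReal_coe]
  linarith

/-- The slack `η` accounts for suprema over adversaries that are not attained. -/
theorem objective_le_value_add {W : S → ℝ} {η : ℝ}
    (hW : ∀ s, ((W s - η : ℝ) : EReal) ≤
      k.objective (-G.continuationQ W s) (x s) (q s) (p s)) (s : S) :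
    k.objective (-G.continuationQ W s) (x s) (q s) (p s) ≤
      G.value k x q p s + ((G.γ * (η / (1 - G.γ)) : ℝ) : EReal) := by
  have hpen : ∀ s, k.penalty (p s) (q s) ≠ ⊤ := fun s =>
    k.objective_ne_bot_iff.1 (ne_bot_of_le_ne_bot (EReal.coe_ne_bot _) (hW s))
  have hbot := G.value_ne_bot_of_penalty_ne_top (x := x) hpen
  by_cases htop : G.value k x q p s = ⊤
  · rw [htop, EReal.top_add_coe]
    exact le_top
  have hs : G.ValueFinite k x q p s := ⟨htop, hbot s⟩
  have hle : ∀ s, G.ValueFinite k x q p s →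
      W s - (G.value k x q p s).toReal ≤ η / (1 - G.γ) := by
    intro s hs
    refine le_of_forall_le_add_transition (d := fun s => W s - (G.value k x q p s).toReal)
      (fun s hs => ?_) hs
    have h1 := hW s
    rw [hs.objective_continuationQ W, EReal.coe_le_coe_iff] at h1
    linarith
  have hmono := discounted_sum_transition_le hle hs
  rw [hs.objective_continuationQ W, ← EReal.coe_toReal hs.1 hs.2, ← EReal.coe_add,
    EReal.coe_le_coe_iff, EReal.toReal_coe]
  linarith

theorem le_riskValue_of_le_riskObjective {W : S → ℝ}
    (hW : ∀ s, (W s : EReal) ≤ k.riskObjective (-G.continuationQ W s) (x s) (q s)) (s : S) :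
    (W s : EReal) ≤ G.riskValue k x q s := by
  have hγ : 0 < 1 - G.γ := sub_pos.2 G.γ_lt_one
  refine EReal.ge_of_forall_gt_iff_ge.1 fun c hc => ?_
  have hc : c < W s := by exact_mod_cast hc
  -- a loss of `η` in every period adds up to `η / (1 - γ) = W s - c`
  set η := (1 - G.γ) * (W s - c) with hη
  have hη0 : 0 < η := mul_pos hγ (sub_pos.2 hc)
  have hex : ∀ s, ∃ p, ((W s - η : ℝ) : EReal) <
      k.objective (-G.continuationQ W s) (x s) (q s) p := fun s =>
    lt_iSup_iff.1 (lt_of_lt_of_le (by exact_mod_cast sub_lt_self _ hη0) (hW s))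
  choose p hp using hex
  have h := (hp s).le.trans (objective_le_value_add (fun s => (hp s).le) s)
  have hdiv : η / (1 - G.γ) = W s - c := by
    rw [hη, mul_div_cancel_left₀ _ hγ.ne']
  have hsplit : W s - η = c + G.γ * (W s - c) := by
    rw [hη]
    ring
  rw [hdiv, hsplit, EReal.coe_add] at h
  exact ((EReal.addLECancellable_coe _).add_le_add_iff_right.1 h).trans
    (le_iSup (fun p => G.value k x q p s) p)

end MarkovGame

/-! ### Values of stage games -/

section NormalForm

variable {X Y : Type*} [Fintype X] [Fintype Y] {k₁ : Preferences X Y} {k₂ : Preferences Y X}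
  {R₁ : X → Y → ℝ} {R₂ : Y → X → ℝ} {z : stdSimplex ℝ X × stdSimplex ℝ Y}

theorem rqeValue_eq (h : ∃! z, IsRQE k₁ k₂ R₁ R₂ z) (hz : IsRQE k₁ k₂ R₁ R₂ z) :
    rqeValue k₁ k₂ R₁ R₂ = ((k₁.riskObjective R₁ z.1 z.2).toReal,
      (k₂.riskObjective R₂ z.2 z.1).toReal) := by
  have : h.choose = z := h.unique h.choose_spec.1 hz
  rw [rqeValue, dif_pos h, this]

theorem Preferences.coe_toReal_riskObjective_of_le (k : Preferences X Y) {R : X → Y → ℝ}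
    {x : stdSimplex ℝ X} {q : stdSimplex ℝ Y}
    (h : ∀ y, k.riskObjective R x q ≤ k.riskObjective R y q) :
    ((k.riskObjective R x q).toReal : EReal) = k.riskObjective R x q := by
  obtain ⟨y, hy⟩ := k.exists_regularization_ne_top
  exact EReal.coe_toReal (ne_top_of_le_ne_top (k.riskObjective_ne_top hy R q) (h y))
    (k.riskObjective_ne_bot R x q)

end NormalForm

namespace MarkovGame

variable {S A₁ A₂ : Type*} [Fintype S] [Fintype A₁] [Fintype A₂]
variable {G : MarkovGame S A₁ A₂}
variable {x : S → stdSimplex ℝ A₁} {q p : S → stdSimplex ℝ A₂} {k : Preferences A₁ A₂}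

/-! ### Stage-game optimality and optimality in the Markov game -/

theorem riskValue_le_of_stage {Q : S → A₁ → A₂ → ℝ}
    (hQ : Q = G.continuationQ fun s => (k.riskObjective (-Q s) (x s) (q s)).toReal)
    (hx : ∀ s y, k.riskObjective (-Q s) (x s) (q s) ≤ k.riskObjective (-Q s) y (q s))
    (s : S) (y : S → stdSimplex ℝ A₁) : G.riskValue k x q s ≤ G.riskValue k y q s := by
  set W : S → ℝ := fun s => (k.riskObjective (-Q s) (x s) (q s)).toReal
  have hW : ∀ s, (W s : EReal) = k.riskObjective (-Q s) (x s) (q s) := fun s =>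
    k.coe_toReal_riskObjective_of_le (hx s)
  rw [hQ] at hW hx
  calc G.riskValue k x q s ≤ k.riskObjective (-G.continuationQ W s) (x s) (q s) :=
        riskValue_le_riskObjective (fun s => (hW s).ge) s
    _ = W s := (hW s).symm
    _ ≤ G.riskValue k y q s :=
        le_riskValue_of_le_riskObjective (fun s => (hW s).trans_le (hx s (y s))) s

/-- Any constant policy with finite regularization will do: its stage objective does not exceed
constant continuation values that are large enough. -/
theorem exists_riskValue_ne_top (G : MarkovGame S A₁ A₂) (k : Preferences A₁ A₂)
    (q : S → stdSimplex ℝ A₂) : ∃ x : S → stdSimplex ℝ A₁, ∀ s, G.riskValue k x q s ≠ ⊤ := by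
  obtain ⟨x, hx⟩ := k.exists_regularization_ne_top
  choose C hC using fun s => k.exists_riskObjective_le (q s) hx
  have hγ : 0 < 1 - G.γ := sub_pos.2 G.γ_lt_one
  -- `M` solves `∑ |C| + γ M = M`
  set M : ℝ := (∑ s, |C s|) / (1 - G.γ) with hM
  have hMeq : ∑ s, |C s| + G.γ * M = M := by
    rw [hM]
    field_simp
    ring
  have hW : ∀ s, k.riskObjective (-G.continuationQ (fun _ => M) s) x (q s) ≤ M := by
    intro s
    refine (hC s _ (G.γ * M) fun a b => ?_).trans ?_
    · have := (G.r₁_mem s a b).1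
      simp only [Pi.neg_apply, continuationQ, neg_neg, ← Finset.sum_mul, stdSimplex.sum_eq_one]
      linarith
    · have := Finset.single_le_sum (f := fun s => |C s|) (fun s _ => abs_nonneg _)
        (Finset.mem_univ s)
      have h2 := le_abs_self (C s)
      exact_mod_cast (by linarith : C s + G.γ * M ≤ M)
  exact ⟨fun _ => x, fun s => ne_top_of_le_ne_top (EReal.coe_ne_top M)
    ((riskValue_le_riskObjective hW s).trans (hW s))⟩

theorem IsBestAdversary.riskValue_eq (hp : G.IsBestAdversary k x q p) (s : S) :
    G.riskValue k x q s = G.value k x q p s :=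
  le_antisymm (iSup_le fun p' => hp s p') (le_iSup (fun p => G.value k x q p s) p)

theorem IsBestAdversary.valueFinite (hp : G.IsBestAdversary k x q p)
    (hx : ∀ s y, G.riskValue k x q s ≤ G.riskValue k y q s) (s : S) :
    G.ValueFinite k x q p s := by
  constructor
  · obtain ⟨y, hy⟩ := G.exists_riskValue_ne_top k q
    rw [← hp.riskValue_eq]
    exact ne_top_of_le_ne_top (hy s) (hx s y)
  · choose p' hp' using fun s => k.exists_penalty_ne_top (q s)
    exact ne_bot_of_le_ne_bot (G.value_ne_bot_of_penalty_ne_top hp' s) (hp s p')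

theorem IsBestAdversary.objective_eq (hp : G.IsBestAdversary k x q p)
    (hx : ∀ s y, G.riskValue k x q s ≤ G.riskValue k y q s) (s : S) :
    k.objective (-G.qValue k x q p s) (x s) (q s) (p s) = G.value k x q p s := by
  have hs := hp.valueFinite hx s
  refine (hs.objective_continuationQ fun s => (G.value k x q p s).toReal).trans ?_
  simpa using EReal.coe_toReal hs.1 hs.2

/-- An adversary who gains at one state of the stage game would gain in the Markov game by
deviating at that state only. -/
theorem IsBestAdversary.riskObjective_eq (hp : G.IsBestAdversary k x q p)
    (hx : ∀ s y, G.riskValue k x q s ≤ G.riskValue k y q s) (s : S) :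
    k.riskObjective (-G.qValue k x q p s) (x s) (q s) = G.value k x q p s := by
  classical
  have hobj := hp.objective_eq hx
  refine le_antisymm (iSup_le fun p₀ => ?_) ?_
  · by_contra! hlt
    have hW : ∀ s', (((G.value k x q p s').toReal - 0 : ℝ) : EReal) ≤
        k.objective (-G.qValue k x q p s') (x s') (q s') (Function.update p s p₀ s') := by
      intro s'
      have hs' := hp.valueFinite hx s'
      rw [sub_zero, EReal.coe_toReal hs'.1 hs'.2]
      by_cases h : s' = s
      · subst h
        simpa using hlt.le
      · simp [Function.update_of_ne h, hobj]
    have h := objective_le_value_add (W := fun s => (G.value k x q p s).toReal) hW s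
    simp only [Function.update_self, zero_div, mul_zero, EReal.coe_zero, add_zero] at h
    exact absurd (hlt.trans_le (h.trans (hp s _))) (lt_irrefl _)
  · rw [← hobj s]
    exact le_iSup (fun p₀ => k.objective (-G.qValue k x q p s) (x s) (q s) p₀) (p s)

/-- A player who gains at one state of the stage game would gain in the Markov game by deviating
at that state only. -/
theorem IsBestAdversary.riskObjective_le (hp : G.IsBestAdversary k x q p)
    (hx : ∀ s y, G.riskValue k x q s ≤ G.riskValue k y q s) (s : S) (y : stdSimplex ℝ A₁) :
    k.riskObjective (-G.qValue k x q p s) (x s) (q s) ≤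
      k.riskObjective (-G.qValue k x q p s) y (q s) := by
  classical
  have hobj := hp.riskObjective_eq hx
  by_contra! hlt
  have hW : ∀ s', k.riskObjective (-G.qValue k x q p s') (Function.update x s y s') (q s') ≤
      ((G.value k x q p s').toReal : EReal) := by
    intro s'
    have hs' := hp.valueFinite hx s'
    rw [EReal.coe_toReal hs'.1 hs'.2, ← hobj]
    by_cases h : s' = s
    · subst h
      simpa using hlt.le
    · simp [Function.update_of_ne h]
  have h := riskValue_le_riskObjective (W := fun s => (G.value k x q p s).toReal) hW s
  rw [Function.update_self] at h
  have h2 := (hx s _).trans_lt (h.trans_lt hlt)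
  rw [hobj, hp.riskValue_eq] at h2
  exact lt_irrefl _ h2

end MarkovGame

theorem mainTheorem3 {S A₁ A₂ : Type*} [Fintype S] [Fintype A₁] [Fintype A₂]
    (G : MarkovGame S A₁ A₂) (k₁ : Preferences A₁ A₂) (k₂ : Preferences A₂ A₁) :
    (∀ Q : MarkovGame.QPair S A₁ A₂,
      (∀ s, MarkovGame.HasUniqueStageRQE k₁ k₂ Q s) →
      Function.IsFixedPt (G.bellman k₁ k₂) Q →
      ∀ (π₁ : S → stdSimplex ℝ A₁) (π₂ : S → stdSimplex ℝ A₂),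
        (∀ s, IsRQE k₁ k₂ (-Q.1 s) (-Q.2 s) (π₁ s, π₂ s)) →
        G.IsMarkovRQE k₁ k₂ π₁ π₂) ∧
    (∀ (π₁ : S → stdSimplex ℝ A₁) (π₂ : S → stdSimplex ℝ A₂)
      (p₁ : S → stdSimplex ℝ A₂) (p₂ : S → stdSimplex ℝ A₁),
      G.IsMarkovRQE k₁ k₂ π₁ π₂ →
      G.IsBestAdversary k₁ π₁ π₂ p₁ →
      G.swap.IsBestAdversary k₂ π₂ π₁ p₂ →
      (∀ s, (G.value k₁ π₁ π₂ p₁ s ≠ ⊤ ∧ G.value k₁ π₁ π₂ p₁ s ≠ ⊥) ∧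
        (G.swap.value k₂ π₂ π₁ p₂ s ≠ ⊤ ∧ G.swap.value k₂ π₂ π₁ p₂ s ≠ ⊥)) ∧
      ((∀ s, MarkovGame.HasUniqueStageRQE k₁ k₂
          (G.qValue k₁ π₁ π₂ p₁, G.swap.qValue k₂ π₂ π₁ p₂) s) →
        Function.IsFixedPt (G.bellman k₁ k₂)
          (G.qValue k₁ π₁ π₂ p₁, G.swap.qValue k₂ π₂ π₁ p₂))) := by
  refine ⟨fun Q huniq hfix π₁ π₂ hπ => ?_, fun π₁ π₂ p₁ p₂ hπ hp₁ hp₂ => ⟨fun s =>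
    ⟨hp₁.valueFinite hπ.1 s, hp₂.valueFinite hπ.2 s⟩, fun huniq => ?_⟩⟩
  · have hval := fun s => rqeValue_eq (huniq s) (hπ s)
    simp only [Function.IsFixedPt, MarkovGame.bellman, hval] at hfix
    exact ⟨MarkovGame.riskValue_le_of_stage (congrArg Prod.fst hfix).symm fun s => (hπ s).1,
      MarkovGame.riskValue_le_of_stage (G := G.swap) (congrArg Prod.snd hfix).symm
        fun s => (hπ s).2⟩
  · have hstage : ∀ s, IsRQE k₁ k₂ (-G.qValue k₁ π₁ π₂ p₁ s) (-G.swap.qValue k₂ π₂ π₁ p₂ s)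
        (π₁ s, π₂ s) := fun s => ⟨hp₁.riskObjective_le hπ.1 s, hp₂.riskObjective_le hπ.2 s⟩
    have hval := fun s => rqeValue_eq (huniq s) (hstage s)
    simp only [hp₁.riskObjective_eq hπ.1, hp₂.riskObjective_eq hπ.2] at hval
    simp only [Function.IsFixedPt, MarkovGame.bellman, hval]
    rfl
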